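/- Let $\mathcal E,\mathcal E'$ be separable complex Hilbert spaces, let $\mathbb D$ be the open unit disc of $\mathbb C$, and let $\mathcal B_1(\mathcal E,\mathcal E')$ be the set of linear contractions from $\mathcal E$ into $\mathcal E'$ (bounded linear operators $T$ with $\|T\|\le 1$). For a contraction $T$ put $D_T=(I-T^*T)^{1/2}$ and let $\mathcal D_T$ be the closure of the range of $D_T$. For $A,B\in\mathcal B_1(\mathcal E,\mathcal E')$, $A$ Shmul'yan dominates $B$ if $B=A+D_{A^*}XD_A$ for some bounded linear $X:\mathcal D_A\to\mathcal D_{A^*}$; $A$ and $B$ are Shmul'yan equivalent if each Shmul'yan dominates the other, and the equivalence classes in $\mathcal B_1(\mathcal E,\mathcal E')$ are called Shmul'yan parts. Let $H_1^\infty(\mathcal E,\mathcal E')$ be the set of all analytic functions $F:\mathbb D\to\mathcal B(\mathcal E,\mathcal E')$ (with respect to the operator norm) such that $\|F(z)\|\le 1$ for all $z\in\mathbb D$. Let $\delta(z,\mu)=\tanh^{-1}\left|\frac{z-\mu}{1-\bar\mu z}\right|$ be the hyperbolic metric on $\mathbb D$, and define the Kobayashi pseudo-distance $$\delta_K(T,T')=\inf\sum_{j=1}^n\delta(0,\lambda_j)\in[0,\infty],$$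 where the infimum is over all $n\ge 1$ and all finite systems $\lambda_1,\dots,\lambda_n\in\mathbb D$ for which there are $F_1,\dots,F_n\in H_1^\infty(\mathcal E,\mathcal E')$ with $F_1(0)=T$, $F_j(\lambda_j)=F_{j+1}(0)$ for $1\le j\le n-1$, and $F_n(\lambda_n)=T'$ (and $\delta_K(T,T')=\infty$ if there is no such system). **Theorem.** Let $T,T'\in\mathcal B_1(\mathcal E,\mathcal E')$. The following are equivalent: (i) $T$ and $T'$ are in the same Shmul'yan part; (ii) there exist $\lambda_0\in\mathbb D$ and $F\in H_1^\infty(\mathcal E,\mathcal E')$ such that $F(0)=T$ and $F(\lambda_0)=T'$; (iii) $\delta_K(T,T')<\infty$. -/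

import Mathlib

open scoped ENNReal InnerProductSpace

noncomputable section

namespace Shmulyan

variable {E E' : Type*}
  [NormedAddCommGroup E] [InnerProductSpace ℂ E] [CompleteSpace E]
  [NormedAddCommGroup E'] [InnerProductSpace ℂ E'] [CompleteSpace E']

variable (E E') in
/-- The set `B₁(E, E')` of linear contractions from `E` into `E'`. -/
def contractions : Set (E →L[ℂ] E') := {T | ‖T‖ ≤ 1}

/-- The defect operator `D_T = (I - T* T)^{1/2}` of a contraction `T`. -/
def defectOp (T : E →L[ℂ] E') : E →L[ℂ] E :=
  CFC.sqrt (1 - ContinuousLinearMap.adjoint T ∘L T)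

/-- The defect space of `T`: the closure of the range of `D_T`. -/
def defectSpace (T : E →L[ℂ] E') : Submodule ℂ E :=
  (LinearMap.range (defectOp T).toLinearMap).topologicalClosure

/-- The defect operator viewed as an operator from `E` into the defect space. -/
def defectOpRestrict (T : E →L[ℂ] E') : E →L[ℂ] defectSpace T :=
  (defectOp T).codRestrict (defectSpace T)
    (fun x => Submodule.le_topologicalClosure _ (LinearMap.mem_range_self _ x))

/-- `Dominates A B`: `A` Shmul'yan dominates `B`, i.e. `B = A + D_{A*} X D_A` for some bounded
operator `X` from the defect space of `A` into the defect space of `A*`. -/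
def Dominates (A B : E →L[ℂ] E') : Prop :=
  ∃ X : defectSpace A →L[ℂ] defectSpace (ContinuousLinearMap.adjoint A),
    B = A + defectOp (ContinuousLinearMap.adjoint A) ∘L
      (defectSpace (ContinuousLinearMap.adjoint A)).subtypeL ∘L X ∘L defectOpRestrict A

/-- Shmul'yan equivalence: each of the two operators Shmul'yan dominates the other. -/
def Equivalent (A B : E →L[ℂ] E') : Prop := Dominates A B ∧ Dominates B A

/-- The Shmul'yan part of `S`: all contractions that are Shmul'yan equivalent to `S`. -/
def part (S : E →L[ℂ] E') : Set (E →L[ℂ] E') :=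
  {B | B ∈ contractions E E' ∧ Equivalent S B}

variable (E E') in
/-- The collection of all Shmul'yan parts of `B₁(E, E')`. -/
def parts : Set (Set (E →L[ℂ] E')) :=
  {P | ∃ S ∈ contractions E E', P = part S}

end Shmulyan

namespace Kobayashi

variable {E E' : Type*}
  [NormedAddCommGroup E] [InnerProductSpace ℂ E]
  [NormedAddCommGroup E'] [InnerProductSpace ℂ E']

variable (E E') in
/-- The operator-valued Schur class `H₁^∞(E, E')`: functions that are analytic on the open unit
disc, in the operator norm, with contractive values there (values off the disc are irrelevant). -/
def schurClass : Set (ℂ → E →L[ℂ] E') :=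
  {F | AnalyticOnNhd ℂ F (Metric.ball 0 1) ∧ ∀ z ∈ Metric.ball (0 : ℂ) 1, ‖F z‖ ≤ 1}

/-- The hyperbolic metric on the open unit disc. -/
def hyperbolicDist (z μ : ℂ) : ℝ :=
  Real.artanh ‖(z - μ) / (1 - (starRingEnd ℂ) μ * z)‖

/-- The system `lam 0, …, lam n` of `n + 1` points of the unit disc is admissible for `(T, T')`:
there are Schur functions `F 0, …, F n` with `F 0 (0) = T`, `F j (lam j) = F (j + 1) (0)` for
`j < n`, and `F n (lam n) = T'`. -/
def IsAdmissible (T T' : E →L[ℂ] E') {n : ℕ} (lam : Fin (n + 1) → ℂ) : Prop :=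
  (∀ j, lam j ∈ Metric.ball (0 : ℂ) 1) ∧
  ∃ F : Fin (n + 1) → ℂ → E →L[ℂ] E',
    (∀ j, F j ∈ schurClass E E') ∧
    F 0 0 = T ∧
    (∀ j : Fin n, F j.castSucc (lam j.castSucc) = F j.succ 0) ∧
    F (Fin.last n) (lam (Fin.last n)) = T'

/-- The Kobayashi pseudo-distance `δ_K(T, T') ∈ [0, ∞]`; it is `∞` when there is no admissible
system. -/
def pseudoDist (T T' : E →L[ℂ] E') : ℝ≥0∞ :=
  ⨅ (n : ℕ) (lam : Fin (n + 1) → ℂ) (_ : IsAdmissible T T' lam),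
    ENNReal.ofReal (∑ j, hyperbolicDist 0 (lam j))

end Kobayashi

end

/-!
A contraction `A` is characterised by `‖x‖² + ‖y‖² + 2 Re ⟪y, A x⟫ ≥ 0`. Along a Schur function `F`
the expression `‖x‖² + ‖y‖² + 2 ⟪y, F z x⟫` is holomorphic in `z` with values in the right half
plane, so the Schwarz–Pick lemma bounds `|⟪y, (F l - F 0) x⟫|` by a multiple of the quadratic forms
of both `F 0` and `F l`. On the pairs `(x, -A x)` and `(-A* y, y)` the form of `A` equals
`‖D_A x‖²` and `‖D_{A*} y‖²`, so polarization turns this bound into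
`|⟪y, (F l - F 0) x⟫| ≤ c ‖D_A x‖ ‖D_{A*} y‖`, which by Douglas factorization is Shmul'yan
domination. As Shmul'yan equivalence is transitive, the same holds along chains.

Conversely let `B = A + D_{A*} Y D_A`. Then `‖x‖² - ‖B x‖² = ‖v - A* Y v‖² - ‖Y v‖²` with
`v = D_A x`, so `B` is a contraction iff `‖Y v‖ ≤ ‖v - A* Y v‖` for all `v`. This makes `1 - A* Y`
coercive, and `Y = Z (1 + A* Z)⁻¹` with the contraction `Z = Y (1 - A* Y)⁻¹`. If `B` dominates `A`
as well, then `‖Z‖ < 1`, so `Z = l W` with `‖W‖ ≤ 1` and `|l| < 1`, and replacing `Z` by `z W` gives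
a Schur function with value `A` at `0` and `B` at `l`.
-/

section HalfPlane

open Metric
open scoped ComplexConjugate

variable {V : Type*} [NormedAddCommGroup V] [NormedSpace ℂ V] {f : V → ℂ} {c z : V} {R : ℝ}

theorem norm_sub_le_norm_add_conj {a b : ℂ} (ha : 0 ≤ a.re) (hb : 0 ≤ b.re) :
    ‖a - b‖ ≤ ‖a + conj b‖ := by
  refine le_of_sq_le_sq ?_ (norm_nonneg _)
  rw [← Complex.normSq_eq_norm_sq, ← Complex.normSq_eq_norm_sq, Complex.normSq_sub,
    Complex.normSq_add, Complex.conj_conj, Complex.normSq_conj, Complex.mul_re, Complex.mul_re,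
    Complex.conj_re, Complex.conj_im]
  nlinarith [mul_nonneg ha hb]

theorem norm_sub_le_dist_div_mul_of_re_pos (hf : DifferentiableOn ℂ f (ball c R))
    (hre : ∀ w ∈ ball c R, 0 < (f w).re) (hz : z ∈ ball c R) :
    ‖f z - f c‖ ≤ dist z c / R * ‖f z + conj (f c)‖ := by
  have hc : c ∈ ball c R := mem_ball_self (dist_nonneg.trans_lt hz)
  have hne {w : V} (hw : w ∈ ball c R) : f w + conj (f c) ≠ 0 := fun h => by
    have := congrArg Complex.re h
    rw [Complex.add_re, Complex.conj_re, Complex.zero_re] at this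
    linarith [hre w hw, hre c hc]
  have hmaps : Set.MapsTo (fun w => (f w - f c) * (f w + conj (f c))⁻¹) (ball c R)
      (closedBall ((f c - f c) * (f c + conj (f c))⁻¹) 1) := fun w hw => by
    beta_reduce
    rw [sub_self, zero_mul, mem_closedBall_zero_iff, ← div_eq_mul_inv, norm_div]
    exact div_le_one_of_le₀ (norm_sub_le_norm_add_conj (hre w hw).le (hre c hc).le)
      (norm_nonneg _)
  have hschwarz := Complex.dist_le_div_mul_dist_of_mapsTo_ball
    ((hf.sub_const _).fun_mul ((hf.add_const _).fun_inv fun w => hne)) hmaps hz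
  rw [sub_self, zero_mul, dist_zero_right, ← div_eq_mul_inv, norm_div,
    div_le_iff₀ (norm_pos_iff.2 (hne hz)), one_div_mul_eq_div] at hschwarz
  exact hschwarz

theorem norm_sub_le_dist_div_mul_of_re_nonneg (hf : DifferentiableOn ℂ f (ball c R))
    (hre : ∀ w ∈ ball c R, 0 ≤ (f w).re) (hz : z ∈ ball c R) :
    ‖f z - f c‖ ≤ dist z c / R * ‖f z + conj (f c)‖ := by
  have hlim : Filter.Tendsto
      (fun ε : ℝ => dist z c / R * ‖(f z + ε) + conj (f c + ε)‖) (nhdsWithin 0 (Set.Ioi 0))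
      (nhds (dist z c / R * ‖(f z + (0 : ℝ)) + conj (f c + (0 : ℝ))‖)) :=
    (Continuous.tendsto (by fun_prop) 0).mono_left nhdsWithin_le_nhds
  rw [Complex.ofReal_zero, add_zero, add_zero] at hlim
  refine ge_of_tendsto hlim (eventually_mem_nhdsWithin.mono fun ε (hε : 0 < ε) => ?_)
  have hpos (w) (hw : w ∈ ball c R) : 0 < (f w + ε).re := by
    rw [Complex.add_re, Complex.ofReal_re]
    linarith [hre w hw]
  simpa only [add_sub_add_right_eq_sub] using
    norm_sub_le_dist_div_mul_of_re_pos (hf.add_const (ε : ℂ)) hpos hz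

theorem one_sub_mul_norm_sub_le_of_norm_sub_le {a b : ℂ} {r : ℝ} (hr : 0 ≤ r) (hb : 0 ≤ b.re)
    (h : ‖a - b‖ ≤ r * ‖a + conj b‖) : (1 - r) * ‖a - b‖ ≤ 2 * r * b.re := by
  have htri : ‖a + conj b‖ ≤ ‖a - b‖ + 2 * b.re := by
    calc ‖a + conj b‖ = ‖(a - b) + (b + conj b)‖ := by ring_nf
      _ ≤ ‖a - b‖ + ‖b + conj b‖ := norm_add_le _ _
      _ = ‖a - b‖ + 2 * b.re := by
        rw [Complex.add_conj, Complex.norm_real, Real.norm_of_nonneg (by positivity)]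
  nlinarith

theorem one_sub_mul_norm_sub_le_min_re (hf : DifferentiableOn ℂ f (ball c R))
    (hre : ∀ w ∈ ball c R, 0 ≤ (f w).re) (hz : z ∈ ball c R) :
    (1 - dist z c / R) * ‖f z - f c‖ ≤ 2 * (dist z c / R) * min (f c).re (f z).re := by
  have hR : 0 < R := dist_nonneg.trans_lt hz
  have hr : 0 ≤ dist z c / R := by positivity
  have hpick := norm_sub_le_dist_div_mul_of_re_nonneg hf hre hz
  rw [mul_min_of_nonneg _ _ (by positivity), le_min_iff]
  refine ⟨one_sub_mul_norm_sub_le_of_norm_sub_le hr (hre c (mem_ball_self hR)) hpick, ?_⟩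
  have hsymm : ‖f c + conj (f z)‖ = ‖f z + conj (f c)‖ := by
    rw [← Complex.norm_conj, map_add, Complex.conj_conj, add_comm]
  rw [norm_sub_rev] at hpick ⊢
  exact one_sub_mul_norm_sub_le_of_norm_sub_le hr (hre z hz) (hsymm ▸ hpick)

end HalfPlane

section Polarization

variable {V : Type*} [AddCommGroup V] [Module ℂ V] {S M : V →ₗ⋆[ℂ] V →ₗ[ℂ] ℂ}

theorem norm_apply_le_add_of_norm_apply_self_le (h : ∀ v, ‖S v v‖ ≤ (M v v).re) (v w : V) :
    ‖S v w‖ ≤ (M v v).re + (M w w).re := by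
  have hpol : 4 * S v w = S (v + w) (v + w) - S (v - w) (v - w) -
      Complex.I * S (v + Complex.I • w) (v + Complex.I • w) +
      Complex.I * S (v - Complex.I • w) (v - Complex.I • w) := by
    simp only [map_add, map_sub, map_smulₛₗ, LinearMap.add_apply, LinearMap.sub_apply,
      LinearMap.smul_apply, Complex.conj_I, smul_eq_mul, RingHom.id_apply]
    linear_combination 2 * (S v w - S w v) * Complex.I_mul_I
  have hpar : M (v + w) (v + w) + M (v - w) (v - w) + M (v + Complex.I • w) (v + Complex.I • w) +
      M (v - Complex.I • w) (v - Complex.I • w) = 4 * (M v v + M w w) := by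
    simp only [map_add, map_sub, map_smulₛₗ, LinearMap.add_apply, LinearMap.sub_apply,
      LinearMap.smul_apply, Complex.conj_I, smul_eq_mul, RingHom.id_apply]
    linear_combination -2 * M w w * Complex.I_mul_I
  have hnorm : ‖4 * S v w‖ ≤ ‖S (v + w) (v + w)‖ + ‖S (v - w) (v - w)‖ +
      ‖S (v + Complex.I • w) (v + Complex.I • w)‖ +
      ‖S (v - Complex.I • w) (v - Complex.I • w)‖ := by
    rw [hpol]
    refine (norm_add_le _ _).trans (add_le_add ((norm_sub_le _ _).trans
      (add_le_add (norm_sub_le _ _) ?_)) ?_) <;>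
    rw [norm_mul, Complex.norm_I, one_mul]
  rw [norm_mul, Complex.norm_ofNat] at hnorm
  have hre := congrArg Complex.re hpar
  simp only [Complex.add_re, Complex.mul_re, Complex.re_ofNat, Complex.im_ofNat] at hre
  linarith [h (v + w), h (v - w), h (v + Complex.I • w), h (v - Complex.I • w)]

theorem norm_apply_sq_le_of_norm_apply_self_le (h : ∀ v, ‖S v v‖ ≤ (M v v).re) (v w : V) :
    ‖S v w‖ ^ 2 ≤ 4 * (M v v).re * (M w w).re := by
  have hquad (t : ℝ) : 0 ≤ (M v v).re * (t * t) + -‖S v w‖ * t + (M w w).re := by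
    have hscale := norm_apply_le_add_of_norm_apply_self_le h ((t : ℂ) • v) w
    simp only [map_smulₛₗ, LinearMap.smul_apply, Complex.conj_ofReal, smul_eq_mul, norm_mul,
      Complex.norm_real, Real.norm_eq_abs, RingHom.id_apply, Complex.re_ofReal_mul] at hscale
    nlinarith [le_abs_self t, norm_nonneg (S v w)]
  have hdiscrim := discrim_le_zero hquad
  rw [discrim] at hdiscrim
  linarith

end Polarization

section Intertwining

open ContinuousLinearMap

variable {E E' : Type*}
  [NormedAddCommGroup E] [InnerProductSpace ℂ E] [CompleteSpace E]
  [NormedAddCommGroup E'] [InnerProductSpace ℂ E'] [CompleteSpace E']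
  {R : E →L[ℂ] E} {S : E' →L[ℂ] E'} {W : E →L[ℂ] E'}

theorem comp_eq_zero_of_comp_eq_neg_comp (hS : 0 ≤ S) (hR : 0 ≤ R) (hW : S ∘L W = -(W ∘L R)) :
    W ∘L R = 0 := by
  -- `P R` is self-adjoint, so `P` and `R` commute; hence `0 ≤ P R`, while `P R = -W* S W ≤ 0`.
  set P : E →L[ℂ] E := adjoint W ∘L W
  have hP : 0 ≤ P := (nonneg_iff_isPositive _).2 W.isPositive_adjoint_comp_self
  have hPR : P * R = -(adjoint W ∘L S ∘L W) := by
    rw [hW, comp_neg, neg_neg]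
    rfl
  have hQ : 0 ≤ adjoint W ∘L S ∘L W :=
    (nonneg_iff_isPositive _).2 (((nonneg_iff_isPositive _).1 hS).adjoint_conj W)
  have hcomm : Commute P R := (hP.isSelfAdjoint.commute_iff hR.isSelfAdjoint).2 <| by
    rw [hPR]
    exact hQ.isSelfAdjoint.neg
  have hPR_zero : P * R = 0 :=
    le_antisymm (hPR ▸ neg_nonpos.2 hQ) (hcomm.mul_nonneg hP hR)
  refine adjoint_comp_self_eq_zero_iff.1 ?_
  calc adjoint (W ∘L R) ∘L W ∘L R = adjoint R ∘L (P * R) := by rw [adjoint_comp]; rfl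
    _ = 0 := by rw [hPR_zero, comp_zero]

theorem comp_eq_comp_of_comp_comp_eq (hS : 0 ≤ S) (hR : 0 ≤ R) {T : E →L[ℂ] E'}
    (h : (S ∘L S) ∘L T = T ∘L (R ∘L R)) : S ∘L T = T ∘L R := by
  set W := S ∘L T - T ∘L R with hW
  have hanti : S ∘L W = -(W ∘L R) := by
    rw [hW, comp_sub, sub_comp, neg_sub, ← comp_assoc, h]
    simp only [comp_assoc]
  have hWR : W ∘L R = 0 := comp_eq_zero_of_comp_eq_neg_comp hS hR hanti
  have hSW : S ∘L W = 0 := by rw [hanti, hWR, neg_zero]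
  have hadj : adjoint W = adjoint T ∘L S - R ∘L adjoint T := by
    rw [hW, map_sub, adjoint_comp, adjoint_comp, hS.isSelfAdjoint.adjoint_eq,
      hR.isSelfAdjoint.adjoint_eq]
  have hgram : adjoint W ∘L W = -(R ∘L adjoint T ∘L W) := by
    rw [hadj, sub_comp, comp_assoc, hSW, comp_zero, zero_sub, comp_assoc]
  have hWW : W ∘L adjoint W ∘L W = 0 := by
    rw [hgram, comp_neg, ← comp_assoc, hWR, zero_comp, neg_zero]
  have hgram_zero : adjoint W ∘L W = 0 := adjoint_comp_self_eq_zero_iff.1 <| by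
    rw [adjoint_comp, adjoint_adjoint, comp_assoc, hWW, comp_zero]
  exact sub_eq_zero.1 (adjoint_comp_self_eq_zero_iff.1 hgram_zero)

end Intertwining

section Douglas

open ContinuousLinearMap

theorem exists_comp_eq_of_norm_le {𝕜 V K W : Type*} [NontriviallyNormedField 𝕜]
    [NormedAddCommGroup V] [NormedSpace 𝕜 V] [NormedAddCommGroup K] [NormedSpace 𝕜 K]
    [NormedAddCommGroup W] [NormedSpace 𝕜 W] [CompleteSpace W]
    {C : V →L[𝕜] W} {D : V →L[𝕜] K} {c : ℝ} (hD : DenseRange D)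
    (h : ∀ x, ‖C x‖ ≤ c * ‖D x‖) : ∃ Z : K →L[𝕜] W, Z ∘L D = C :=
  ⟨C.toLinearMap.extendOfNorm D.toLinearMap,
    ext (LinearMap.extendOfNorm_eq (e := D.toLinearMap) hD ⟨c, h⟩)⟩

variable {𝕜 E E' K K' : Type*} [RCLike 𝕜]
  [NormedAddCommGroup E] [InnerProductSpace 𝕜 E] [CompleteSpace E]
  [NormedAddCommGroup E'] [InnerProductSpace 𝕜 E'] [CompleteSpace E']
  [NormedAddCommGroup K] [InnerProductSpace 𝕜 K]
  [NormedAddCommGroup K'] [InnerProductSpace 𝕜 K'] [CompleteSpace K']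
  {D : E →L[𝕜] K} {D' : E' →L[𝕜] K'} {C : E →L[𝕜] E'} {c : ℝ}

theorem norm_le_of_forall_norm_inner_le_of_denseRange {V : Type*} {f : V → K} (hf : DenseRange f)
    {u : K} (hc : 0 ≤ c) (h : ∀ x, ‖⟪f x, u⟫_𝕜‖ ≤ c * ‖f x‖) : ‖u‖ ≤ c := by
  have hu : ‖⟪u, u⟫_𝕜‖ ≤ c * ‖u‖ :=
    hf.induction_on (p := fun k => ‖⟪k, u⟫_𝕜‖ ≤ c * ‖k‖) u
      (isClosed_le (by fun_prop) (by fun_prop)) h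
  rw [← inner_self_re_eq_norm, inner_self_eq_norm_mul_norm] at hu
  rcases (norm_nonneg u).eq_or_lt with hzero | hpos
  · exact hzero ▸ hc
  · exact le_of_mul_le_mul_right hu hpos

theorem exists_eq_adjoint_comp_comp_of_norm_inner_le (hD : DenseRange D) (hD' : DenseRange D')
    (hc : 0 ≤ c) (h : ∀ x y, ‖⟪y, C x⟫_𝕜‖ ≤ c * ‖D x‖ * ‖D' y‖) :
    ∃ X : K →L[𝕜] K', C = adjoint D' ∘L X ∘L D := by
  have hC (y : E') : ‖adjoint C y‖ ≤ (c * ‖D‖) * ‖D' y‖ :=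
    norm_le_of_forall_norm_inner_le_of_denseRange (𝕜 := 𝕜) denseRange_id (by positivity)
      fun x => by
        rw [id, adjoint_inner_right, norm_inner_symm]
        calc ‖⟪y, C x⟫_𝕜‖ ≤ c * ‖D x‖ * ‖D' y‖ := h x y
          _ ≤ c * (‖D‖ * ‖x‖) * ‖D' y‖ := by gcongr; exact D.le_opNorm x
          _ = c * ‖D‖ * ‖D' y‖ * ‖x‖ := by ring
  obtain ⟨W, hW⟩ := exists_comp_eq_of_norm_le hD' hC
  have hWD (x : E) : ‖adjoint W x‖ ≤ c * ‖D x‖ :=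
    norm_le_of_forall_norm_inner_le_of_denseRange (𝕜 := 𝕜) hD' (by positivity) fun y => by
      rw [adjoint_inner_right, ← comp_apply, hW, adjoint_inner_left]
      exact h x y
  obtain ⟨X, hX⟩ := exists_comp_eq_of_norm_le hD hWD
  refine ⟨X, ?_⟩
  rw [hX, ← adjoint_comp, hW, adjoint_adjoint]

end Douglas

theorem norm_apply_le_of_norm_le_one {𝕜 V W : Type*} [NontriviallyNormedField 𝕜]
    [NormedAddCommGroup V] [NormedSpace 𝕜 V] [NormedAddCommGroup W] [NormedSpace 𝕜 W]
    {T : V →L[𝕜] W} (hT : ‖T‖ ≤ 1) (x : V) : ‖T x‖ ≤ ‖x‖ := by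
  simpa using T.le_of_opNorm_le hT x

section Feedback

open ContinuousLinearMap

section NormedSpace

variable {𝕜 V W : Type*} [NontriviallyNormedField 𝕜]
  [NormedAddCommGroup V] [NormedSpace 𝕜 V] [NormedAddCommGroup W] [NormedSpace 𝕜 W]
  {N : W →L[𝕜] V} {Y Z : V →L[𝕜] W}

/-- The linear fractional transform `Z (1 + N Z)⁻¹` of `Z`, which is the closed-loop operator of
`Z` under the feedback `N`. The inverse is `Ring.inverse`, so the value is `0` where `1 + N Z` is
not invertible. -/
noncomputable def feedback (N : W →L[𝕜] V) (Z : V →L[𝕜] W) : V →L[𝕜] W :=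
  Z ∘L Ring.inverse (1 + N ∘L Z)

theorem feedback_zero (N : W →L[𝕜] V) : feedback N 0 = 0 := zero_comp _

theorem norm_feedback_apply_le (hZ : ‖Z‖ ≤ 1) (hunit : IsUnit (1 + N ∘L Z)) (d : V) :
    ‖feedback N Z d‖ ≤ ‖d - N (feedback N Z d)‖ := by
  set v := Ring.inverse (1 + N ∘L Z) d
  have hsolve : v + N (Z v) = d := DFunLike.congr_fun (Ring.mul_inverse_cancel _ hunit) d
  calc ‖Z v‖ ≤ ‖v‖ := norm_apply_le_of_norm_le_one hZ v
    _ = ‖d - N (Z v)‖ := by rw [← hsolve, add_sub_cancel_right]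

theorem feedback_comp_inverse_one_sub (hunit : IsUnit (1 - N ∘L Y)) :
    feedback N (Y ∘L Ring.inverse (1 - N ∘L Y)) = Y := by
  set R := Ring.inverse (1 - N ∘L Y)
  have hfactor : 1 + N ∘L Y ∘L R = R := by
    calc 1 + N ∘L Y ∘L R = (1 - N ∘L Y) * R + (N ∘L Y) * R := by
          rw [Ring.mul_inverse_cancel _ hunit]
          rfl
      _ = R := by rw [← add_mul, sub_add_cancel, one_mul]
  rw [feedback, hfactor, Ring.inverse_inverse hunit, comp_assoc]
  exact congrArg (Y ∘L ·) (Ring.inverse_mul_cancel _ hunit)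

theorem exists_norm_apply_le_mul_norm_sub {k : ℝ} (hk : 0 < k) (hN : ‖N‖ ≤ 1)
    (h : ∀ v, ‖v‖ ^ 2 ≤ k ^ 2 * (‖v - N (Y v)‖ ^ 2 - ‖Y v‖ ^ 2)) :
    ∃ r, 0 ≤ r ∧ r < 1 ∧ ∀ v, ‖Y v‖ ≤ r * ‖v - N (Y v)‖ := by
  set c := k * (1 + ‖Y‖)
  have hc : 0 < c := by positivity
  refine ⟨√(1 - (c ^ 2)⁻¹), Real.sqrt_nonneg _, ?_, fun v => ?_⟩
  · rw [Real.sqrt_lt' one_pos, one_pow, sub_lt_self_iff]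
    exact inv_pos.2 (pow_pos hc 2)
  set w := v - N (Y v)
  have hw : ‖w‖ ≤ (1 + ‖Y‖) * ‖v‖ := by
    calc ‖w‖ ≤ ‖v‖ + ‖N (Y v)‖ := norm_sub_le _ _
      _ ≤ ‖v‖ + ‖Y‖ * ‖v‖ := by
        gcongr
        exact (norm_apply_le_of_norm_le_one hN _).trans (Y.le_opNorm v)
      _ = (1 + ‖Y‖) * ‖v‖ := by ring
  have hgap : (c ^ 2)⁻¹ * ‖w‖ ^ 2 ≤ ‖w‖ ^ 2 - ‖Y v‖ ^ 2 := by
    rw [inv_mul_le_iff₀ (pow_pos hc 2)]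
    calc ‖w‖ ^ 2 ≤ (1 + ‖Y‖) ^ 2 * ‖v‖ ^ 2 := by
          rw [← mul_pow]
          gcongr
      _ ≤ (1 + ‖Y‖) ^ 2 * (k ^ 2 * (‖w‖ ^ 2 - ‖Y v‖ ^ 2)) := by
          gcongr
          exact h v
      _ = c ^ 2 * (‖w‖ ^ 2 - ‖Y v‖ ^ 2) := by ring
  rw [← Real.sqrt_sq (norm_nonneg w), ← Real.sqrt_mul' _ (sq_nonneg _)]
  refine Real.le_sqrt_of_sq_le ?_
  linarith

theorem differentiable_const_add_comp_comp {V' W' : Type*}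
    [NormedAddCommGroup V'] [NormedSpace 𝕜 V'] [NormedAddCommGroup W'] [NormedSpace 𝕜 W']
    (C : V →L[𝕜] W) (P : W' →L[𝕜] W) (Q : V →L[𝕜] V') :
    Differentiable 𝕜 fun Z : V' →L[𝕜] W' => C + P ∘L Z ∘L Q := fun _ =>
  ((differentiableAt_const P).clm_comp
    (differentiableAt_fun_id.clm_comp (differentiableAt_const Q))).const_add C

variable [CompleteSpace V]

theorem isUnit_one_add_comp (hN : ‖N‖ ≤ 1) (hZ : ‖Z‖ < 1) : IsUnit (1 + N ∘L Z) := by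
  have hlt : ‖-(N ∘L Z)‖ < 1 := by
    rw [norm_neg]
    calc ‖N ∘L Z‖ ≤ ‖N‖ * ‖Z‖ := opNorm_comp_le N Z
      _ < 1 := mul_lt_one_of_nonneg_of_lt_one_right hN (norm_nonneg Z) hZ
  simpa only [sub_neg_eq_add] using isUnit_one_sub_of_norm_lt_one hlt

theorem differentiableAt_feedback (hunit : IsUnit (1 + N ∘L Z)) :
    DifferentiableAt 𝕜 (feedback N) Z := by
  have hadd : DifferentiableAt 𝕜 (fun Z => 1 + N ∘L Z) Z :=
    ((differentiableAt_const N).clm_comp differentiableAt_fun_id).const_add 1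
  exact differentiableAt_fun_id.clm_comp
    (DifferentiableAt.fun_comp' Z (differentiableAt_inverse hunit) hadd)

end NormedSpace

variable {𝕜 K K' : Type*} [RCLike 𝕜]
  [NormedAddCommGroup K] [InnerProductSpace 𝕜 K] [CompleteSpace K]
  [NormedAddCommGroup K'] [NormedSpace 𝕜 K']
  {N : K' →L[𝕜] K} {Y : K →L[𝕜] K'}

theorem isUnit_one_sub_comp (hN : ‖N‖ ≤ 1) (h : ∀ v, ‖Y v‖ ≤ ‖v - N (Y v)‖) :
    IsUnit (1 - N ∘L Y) := by
  refine isUnit_of_forall_le_norm_inner_map _ (c := 1 / 2) (by norm_num) fun v => ?_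
  set u := N (Y v)
  have hle : ‖u‖ ≤ ‖v - u‖ := (norm_apply_le_of_norm_le_one hN _).trans (h v)
  have hsq : ‖u‖ ^ 2 ≤ ‖v - u‖ ^ 2 := pow_le_pow_left₀ (norm_nonneg _) hle 2
  calc ‖v‖ ^ 2 * (1 / 2 : ℝ) ≤ RCLike.re ⟪v - u, v⟫_𝕜 := by
        rw [norm_sub_sq (𝕜 := 𝕜)] at hsq
        rw [inner_sub_left, map_sub, inner_self_eq_norm_sq, inner_re_symm]
        linarith
    _ ≤ ‖⟪v - u, v⟫_𝕜‖ := RCLike.re_le_norm _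

theorem exists_feedback_eq {r : ℝ} (hr : 0 ≤ r) (hr1 : r ≤ 1) (hN : ‖N‖ ≤ 1)
    (h : ∀ v, ‖Y v‖ ≤ r * ‖v - N (Y v)‖) : ∃ Z, ‖Z‖ ≤ r ∧ feedback N Z = Y := by
  have hunit : IsUnit (1 - N ∘L Y) := isUnit_one_sub_comp hN fun v =>
    (h v).trans (mul_le_of_le_one_left (norm_nonneg _) hr1)
  refine ⟨_, opNorm_le_bound _ hr fun d => ?_, feedback_comp_inverse_one_sub hunit⟩
  set v := Ring.inverse (1 - N ∘L Y) d
  have hsolve : v - N (Y v) = d := DFunLike.congr_fun (Ring.mul_inverse_cancel _ hunit) d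
  calc ‖Y v‖ ≤ r * ‖v - N (Y v)‖ := h v
    _ = r * ‖d‖ := by rw [hsolve]

theorem exists_mem_ball_smul_eq {V : Type*} [NormedAddCommGroup V] [NormedSpace 𝕜 V] {x : V}
    (hx : ‖x‖ < 1) : ∃ l ∈ Metric.ball (0 : 𝕜) 1, ∃ w : V, ‖w‖ ≤ 1 ∧ l • w = x := by
  obtain ⟨s, hxs, hs1⟩ := exists_between hx
  have hs : 0 < s := (norm_nonneg x).trans_lt hxs
  have hnorm : ‖(s : 𝕜)‖ = s := RCLike.norm_of_nonneg hs.le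
  refine ⟨s, by rwa [mem_ball_zero_iff, hnorm], (s : 𝕜)⁻¹ • x, ?_,
    smul_inv_smul₀ (RCLike.ofReal_ne_zero.2 hs.ne') x⟩
  rw [norm_smul, norm_inv, hnorm, inv_mul_le_one₀ hs]
  exact hxs.le

theorem exists_differentiableOn_interpolating {r : ℝ} (hr : 0 ≤ r) (hr1 : r < 1) (hN : ‖N‖ ≤ 1)
    (h : ∀ v, ‖Y v‖ ≤ r * ‖v - N (Y v)‖) :
    ∃ l ∈ Metric.ball (0 : 𝕜) 1, ∃ G : 𝕜 → K →L[𝕜] K',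
      DifferentiableOn 𝕜 G (Metric.ball 0 1) ∧
      (∀ z ∈ Metric.ball 0 1, ∀ v, ‖G z v‖ ≤ ‖v - N (G z v)‖) ∧ G 0 = 0 ∧ G l = Y := by
  obtain ⟨Z, hZ, rfl⟩ := exists_feedback_eq hr hr1.le hN h
  obtain ⟨l, hl, W, hW, rfl⟩ := exists_mem_ball_smul_eq (𝕜 := 𝕜) (hZ.trans_lt hr1)
  have hlt {z : 𝕜} (hz : z ∈ Metric.ball 0 1) : ‖z • W‖ < 1 := by
    rw [norm_smul]
    exact mul_lt_one_of_nonneg_of_lt_one_left (norm_nonneg z) (mem_ball_zero_iff.1 hz) hW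
  have hunit {z : 𝕜} (hz : z ∈ Metric.ball 0 1) : IsUnit (1 + N ∘L (z • W)) :=
    isUnit_one_add_comp hN (hlt hz)
  refine ⟨l, hl, fun z => feedback N (z • W), fun z hz => ?_,
    fun z hz => norm_feedback_apply_le (hlt hz).le (hunit hz), ?_, rfl⟩
  · exact ((differentiableAt_feedback (hunit hz)).comp z
      (differentiableAt_fun_id.smul_const W)).differentiableWithinAt
  · beta_reduce
    rw [zero_smul, feedback_zero]

end Feedback

namespace Shmulyan

open ContinuousLinearMap

section Forms

variable {E E' : Type*}
  [NormedAddCommGroup E] [InnerProductSpace ℂ E] [NormedAddCommGroup E'] [InnerProductSpace ℂ E']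

/-- The sesquilinear form `⟪y, C x'⟫` of `(x, y)` and `(x', y')`, that is, the form of the operator
matrix with lower left corner `C` and zeros elsewhere. -/
noncomputable def cornerForm (C : E →L[ℂ] E') : E × E' →ₗ⋆[ℂ] E × E' →ₗ[ℂ] ℂ :=
  ((innerₛₗ ℂ).comp (LinearMap.snd ℂ E E')).compl₂ (C.toLinearMap ∘ₗ LinearMap.fst ℂ E E')

/-- A form whose diagonal values have real part `‖x‖² + ‖y‖² + 2 Re ⟪y, A x⟫`, which is nonnegative
exactly when `A` is a contraction. The corner is doubled instead of symmetrized so that the form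
depends holomorphically on `A`. -/
noncomputable def contractionForm (A : E →L[ℂ] E') : E × E' →ₗ⋆[ℂ] E × E' →ₗ[ℂ] ℂ :=
  ((innerₛₗ ℂ).comp (LinearMap.fst ℂ E E')).compl₂ (LinearMap.fst ℂ E E') +
    ((innerₛₗ ℂ).comp (LinearMap.snd ℂ E E')).compl₂ (LinearMap.snd ℂ E E') +
    (2 : ℂ) • cornerForm A

theorem cornerForm_apply (C : E →L[ℂ] E') (p q : E × E') :
    cornerForm C p q = ⟪p.2, C q.1⟫_ℂ := rfl

theorem contractionForm_apply (A : E →L[ℂ] E') (p q : E × E') :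
    contractionForm A p q = ⟪p.1, q.1⟫_ℂ + ⟪p.2, q.2⟫_ℂ + 2 * ⟪p.2, A q.1⟫_ℂ := rfl

theorem re_contractionForm_self (A : E →L[ℂ] E') (p : E × E') :
    (contractionForm A p p).re = ‖p.1‖ ^ 2 + ‖p.2‖ ^ 2 + 2 * (⟪p.2, A p.1⟫_ℂ).re := by
  rw [contractionForm_apply, Complex.add_re, Complex.add_re, ← inner_self_eq_norm_sq (𝕜 := ℂ),
    ← inner_self_eq_norm_sq (𝕜 := ℂ), Complex.mul_re, Complex.re_ofNat, Complex.im_ofNat, zero_mul,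
    sub_zero]
  rfl

theorem re_contractionForm_self_nonneg {A : E →L[ℂ] E'} (hA : ‖A‖ ≤ 1) (p : E × E') :
    0 ≤ (contractionForm A p p).re := by
  have hinner : -(‖p.2‖ * ‖p.1‖) ≤ (⟪p.2, A p.1⟫_ℂ).re := by
    refine (neg_le_neg ?_).trans (neg_le_of_abs_le (Complex.abs_re_le_norm _))
    calc ‖⟪p.2, A p.1⟫_ℂ‖ ≤ ‖p.2‖ * ‖A p.1‖ := norm_inner_le_norm _ _
      _ ≤ ‖p.2‖ * ‖p.1‖ := by gcongr; exact norm_apply_le_of_norm_le_one hA p.1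
  rw [re_contractionForm_self]
  nlinarith [sq_nonneg (‖p.1‖ - ‖p.2‖)]

end Forms

variable {E E' : Type*}
  [NormedAddCommGroup E] [InnerProductSpace ℂ E] [CompleteSpace E]
  [NormedAddCommGroup E'] [InnerProductSpace ℂ E'] [CompleteSpace E']
  {A B S T : E →L[ℂ] E'}

theorem norm_adjoint_le_one (hT : ‖T‖ ≤ 1) : ‖adjoint T‖ ≤ 1 := by
  rwa [LinearIsometryEquiv.norm_map]

theorem one_sub_adjoint_comp_self_nonneg (hT : ‖T‖ ≤ 1) : 0 ≤ 1 - adjoint T ∘L T := by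
  have hgram : 0 ≤ adjoint T ∘L T := (nonneg_iff_isPositive _).2 T.isPositive_adjoint_comp_self
  rw [sub_nonneg, ← CStarAlgebra.norm_le_one_iff_of_nonneg _ hgram, norm_adjoint_comp_self]
  exact mul_le_one₀ hT (norm_nonneg T) hT

theorem defectOp_nonneg (T : E →L[ℂ] E') : 0 ≤ defectOp T := CFC.sqrt_nonneg _

theorem adjoint_defectOp (T : E →L[ℂ] E') : adjoint (defectOp T) = defectOp T :=
  (defectOp_nonneg T).isSelfAdjoint.adjoint_eq

theorem defectOp_comp_self (hT : ‖T‖ ≤ 1) :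
    defectOp T ∘L defectOp T = 1 - adjoint T ∘L T :=
  CFC.sqrt_mul_sqrt_self _ (one_sub_adjoint_comp_self_nonneg hT)

theorem norm_sq_defectOp (hT : ‖T‖ ≤ 1) (x : E) :
    ‖defectOp T x‖ ^ 2 = ‖x‖ ^ 2 - ‖T x‖ ^ 2 := by
  rw [apply_norm_sq_eq_inner_adjoint_left, adjoint_defectOp, defectOp_comp_self hT, sub_apply,
    inner_sub_left, map_sub, apply_norm_sq_eq_inner_adjoint_left T, one_apply_eq_self,
    inner_self_eq_norm_sq]

theorem defectOp_adjoint_comp (hT : ‖T‖ ≤ 1) : defectOp (adjoint T) ∘L T = T ∘L defectOp T := by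
  refine comp_eq_comp_of_comp_comp_eq (defectOp_nonneg _) (defectOp_nonneg _) ?_
  rw [defectOp_comp_self (norm_adjoint_le_one hT), defectOp_comp_self hT, adjoint_adjoint,
    sub_comp, comp_sub, comp_assoc]
  rfl

theorem adjoint_comp_defectOp_adjoint (hT : ‖T‖ ≤ 1) :
    adjoint T ∘L defectOp (adjoint T) = defectOp T ∘L adjoint T := by
  simpa only [adjoint_comp, adjoint_defectOp] using congrArg adjoint (defectOp_adjoint_comp hT)

instance (T : E →L[ℂ] E') : CompleteSpace (defectSpace T) :=
  (Submodule.isClosed_topologicalClosure _).completeSpace_coe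

theorem adjoint_defectOpRestrict (T : E →L[ℂ] E') :
    adjoint (defectOpRestrict T) = defectOp T ∘L (defectSpace T).subtypeL := by
  refine ((eq_adjoint_iff _ _).2 fun u x => ?_).symm
  rw [comp_apply, ← adjoint_inner_right, adjoint_defectOp]
  rfl

theorem denseRange_defectOpRestrict (T : E →L[ℂ] E') : DenseRange (defectOpRestrict T) := by
  intro u
  have himage : ((↑) : defectSpace T → E) '' Set.range (defectOpRestrict T) =
      LinearMap.range (defectOp T).toLinearMap := by
    rw [← Set.range_comp]
    rfl
  rw [closure_subtype, himage]
  exact u.2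

/-- The operator `A + D_{A*} Y D_A`, so that `A` Shmul'yan dominates exactly the operators
`perturb A Y`. -/
noncomputable def perturb (A : E →L[ℂ] E') (Y : defectSpace A →L[ℂ] defectSpace (adjoint A)) :
    E →L[ℂ] E' :=
  A + defectOp (adjoint A) ∘L (defectSpace (adjoint A)).subtypeL ∘L Y ∘L defectOpRestrict A

theorem dominates_iff_exists_eq_perturb : Dominates A B ↔ ∃ Y, B = perturb A Y := Iff.rfl

theorem perturb_zero (A : E →L[ℂ] E') : perturb A 0 = A := by
  simp [perturb]

theorem perturb_eq_add_adjoint_comp (A : E →L[ℂ] E')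
    (Y : defectSpace A →L[ℂ] defectSpace (adjoint A)) :
    perturb A Y = A + adjoint (defectOpRestrict (adjoint A)) ∘L Y ∘L defectOpRestrict A := by
  rw [adjoint_defectOpRestrict, comp_assoc]
  rfl

theorem dominates_iff_exists_norm_inner_sub_le :
    Dominates A B ↔ ∃ c, 0 ≤ c ∧ ∀ x y,
      ‖⟪y, (B - A) x⟫_ℂ‖ ≤ c * ‖defectOp A x‖ * ‖defectOp (adjoint A) y‖ := by
  constructor
  · rintro ⟨Y, rfl⟩
    refine ⟨‖Y‖, norm_nonneg Y, fun x y => ?_⟩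
    rw [← perturb, perturb_eq_add_adjoint_comp, add_sub_cancel_left, comp_apply,
      adjoint_inner_right, mul_comm]
    refine (norm_inner_le_norm _ _).trans ?_
    gcongr
    exacts [le_rfl, Y.le_opNorm (defectOpRestrict A x)]
  · rintro ⟨c, hc, hle⟩
    obtain ⟨Y, hY⟩ := exists_eq_adjoint_comp_comp_of_norm_inner_le (denseRange_defectOpRestrict A)
      (denseRange_defectOpRestrict (adjoint A)) hc hle
    exact dominates_iff_exists_eq_perturb.2
      ⟨Y, by rw [perturb_eq_add_adjoint_comp, ← hY, add_sub_cancel]⟩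

theorem Dominates.refl (A : E →L[ℂ] E') : Dominates A A :=
  dominates_iff_exists_eq_perturb.2 ⟨0, (perturb_zero A).symm⟩

theorem Dominates.adjoint (h : Dominates A B) : Dominates (adjoint A) (adjoint B) := by
  obtain ⟨c, hc, hle⟩ := dominates_iff_exists_norm_inner_sub_le.1 h
  refine dominates_iff_exists_norm_inner_sub_le.2 ⟨c, hc, fun y x => ?_⟩
  rw [← map_sub, adjoint_inner_right, norm_inner_symm, adjoint_adjoint, mul_right_comm]
  exact hle x y

theorem adjoint_apply_mem_defectSpace (hA : ‖A‖ ≤ 1) (u : defectSpace (adjoint A)) :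
    adjoint A u ∈ defectSpace A := by
  refine map_mem_closure (adjoint A).continuous u.2 ?_
  rintro _ ⟨y, rfl⟩
  exact ⟨adjoint A y, (DFunLike.congr_fun (adjoint_comp_defectOp_adjoint hA) y).symm⟩

/-- The adjoint `A*` as an operator from the defect space of `A*` to that of `A`. -/
noncomputable def adjointRestrict (A : E →L[ℂ] E') (hA : ‖A‖ ≤ 1) :
    defectSpace (adjoint A) →L[ℂ] defectSpace A :=
  (adjoint A ∘L (defectSpace (adjoint A)).subtypeL).codRestrict (defectSpace A)
    (adjoint_apply_mem_defectSpace hA)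

theorem norm_adjointRestrict_le_one (hA : ‖A‖ ≤ 1) : ‖adjointRestrict A hA‖ ≤ 1 := by
  refine opNorm_le_bound _ zero_le_one fun u => ?_
  rw [one_mul]
  exact norm_apply_le_of_norm_le_one (norm_adjoint_le_one hA) (u : E')

theorem norm_sq_sub_norm_sq_perturb_apply (hA : ‖A‖ ≤ 1)
    (Y : defectSpace A →L[ℂ] defectSpace (adjoint A)) (x : E) :
    ‖x‖ ^ 2 - ‖perturb A Y x‖ ^ 2 =
      ‖defectOpRestrict A x - adjointRestrict A hA (Y (defectOpRestrict A x))‖ ^ 2 -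
        ‖Y (defectOpRestrict A x)‖ ^ 2 := by
  set d := defectOpRestrict A x
  have hcross : ⟪A x, defectOp (adjoint A) (Y d)⟫_ℂ = ⟪d, adjointRestrict A hA (Y d)⟫_ℂ := by
    calc ⟪A x, defectOp (adjoint A) (Y d)⟫_ℂ = ⟪x, (adjoint A ∘L defectOp (adjoint A)) (Y d)⟫_ℂ :=
          (adjoint_inner_right _ _ _).symm
      _ = ⟪x, adjoint (defectOp A) (adjoint A (Y d))⟫_ℂ := by
          rw [adjoint_comp_defectOp_adjoint hA, adjoint_defectOp, comp_apply]
      _ = ⟪d, adjointRestrict A hA (Y d)⟫_ℂ := adjoint_inner_right _ _ _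
  have hY : ‖defectOp (adjoint A) (Y d)‖ ^ 2 = ‖Y d‖ ^ 2 - ‖adjointRestrict A hA (Y d)‖ ^ 2 :=
    norm_sq_defectOp (norm_adjoint_le_one hA) (Y d : E')
  have hd : ‖d‖ ^ 2 = ‖x‖ ^ 2 - ‖A x‖ ^ 2 := norm_sq_defectOp hA x
  have hperturb : perturb A Y x = A x + defectOp (adjoint A) (Y d) := rfl
  rw [hperturb, norm_add_sq (𝕜 := ℂ), norm_sub_sq (𝕜 := ℂ), hcross, hY, hd]
  ring

theorem Dominates.exists_norm_defectOp_le (hA : ‖A‖ ≤ 1) (hB : ‖B‖ ≤ 1) (h : Dominates A B) :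
    ∃ k, 0 < k ∧ ∀ x, ‖defectOp B x‖ ≤ k * ‖defectOp A x‖ := by
  obtain ⟨Y, rfl⟩ := dominates_iff_exists_eq_perturb.1 h
  refine ⟨1 + ‖Y‖, by positivity, fun x => ?_⟩
  set d := defectOpRestrict A x
  have hsub : ‖defectOp (perturb A Y) x‖ ≤ ‖d - adjointRestrict A hA (Y d)‖ := by
    refine le_of_sq_le_sq ?_ (norm_nonneg _)
    rw [norm_sq_defectOp hB, norm_sq_sub_norm_sq_perturb_apply hA]
    exact sub_le_self _ (sq_nonneg _)
  calc ‖defectOp (perturb A Y) x‖ ≤ ‖d‖ + ‖adjointRestrict A hA (Y d)‖ :=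
        hsub.trans (norm_sub_le _ _)
    _ ≤ ‖d‖ + ‖Y‖ * ‖d‖ := by
        gcongr
        exact (norm_apply_le_of_norm_le_one (norm_adjointRestrict_le_one hA) _).trans
          (Y.le_opNorm d)
    _ = (1 + ‖Y‖) * ‖defectOp A x‖ := by
        rw [add_mul, one_mul]
        rfl

theorem Dominates.trans (hA : ‖A‖ ≤ 1) (hS : ‖S‖ ≤ 1) (h : Dominates A S) (h' : Dominates S B) :
    Dominates A B := by
  obtain ⟨c, hc, hAS⟩ := dominates_iff_exists_norm_inner_sub_le.1 h
  obtain ⟨d, hd, hSB⟩ := dominates_iff_exists_norm_inner_sub_le.1 h'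
  obtain ⟨k, hk, hdefect⟩ := h.exists_norm_defectOp_le hA hS
  obtain ⟨l, hl, hdefect_adjoint⟩ := h.adjoint.exists_norm_defectOp_le
    (norm_adjoint_le_one hA) (norm_adjoint_le_one hS)
  refine dominates_iff_exists_norm_inner_sub_le.2 ⟨c + d * k * l, by positivity, fun x y => ?_⟩
  calc ‖⟪y, (B - A) x⟫_ℂ‖ = ‖⟪y, (S - A) x⟫_ℂ + ⟪y, (B - S) x⟫_ℂ‖ := by
        rw [← inner_add_right, ← add_apply, sub_add_sub_cancel']
    _ ≤ ‖⟪y, (S - A) x⟫_ℂ‖ + ‖⟪y, (B - S) x⟫_ℂ‖ := norm_add_le _ _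
    _ ≤ c * ‖defectOp A x‖ * ‖defectOp (ContinuousLinearMap.adjoint A) y‖ +
        d * (k * ‖defectOp A x‖) * (l * ‖defectOp (ContinuousLinearMap.adjoint A) y‖) := by
        gcongr
        · exact hAS x y
        · refine (hSB x y).trans ?_
          gcongr
          exacts [hdefect x, hdefect_adjoint y]
    _ = (c + d * k * l) * ‖defectOp A x‖ * ‖defectOp (ContinuousLinearMap.adjoint A) y‖ := by
        ring

theorem Equivalent.symm (h : Equivalent A B) : Equivalent B A := ⟨h.2, h.1⟩

theorem Equivalent.trans (hA : ‖A‖ ≤ 1) (hS : ‖S‖ ≤ 1) (hB : ‖B‖ ≤ 1) (h : Equivalent A S)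
    (h' : Equivalent S B) : Equivalent A B :=
  ⟨h.1.trans hA hS h'.1, h'.2.trans hB hS h.2⟩

theorem exists_mem_parts_iff :
    (∃ P ∈ parts E E', A ∈ P ∧ B ∈ P) ↔ ‖A‖ ≤ 1 ∧ ‖B‖ ≤ 1 ∧ Equivalent A B := by
  constructor
  · rintro ⟨_, ⟨S, hS, rfl⟩, ⟨hA, hSA⟩, ⟨hB, hSB⟩⟩
    exact ⟨hA, hB, hSA.symm.trans hA hS hB hSB⟩
  · rintro ⟨hA, hB, h⟩
    exact ⟨part A, ⟨A, hA, rfl⟩, ⟨hA, Dominates.refl A, Dominates.refl A⟩, hB, h⟩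

theorem norm_inner_le_of_norm_inner_le_re_contractionForm {C : E →L[ℂ] E'} {c : ℝ} (hA : ‖A‖ ≤ 1)
    (hc : 0 ≤ c) (h : ∀ p : E × E', ‖⟪p.2, C p.1⟫_ℂ‖ ≤ c * (contractionForm A p p).re)
    (x : E) (y : E') :
    ‖⟪y, C x⟫_ℂ‖ ≤ 2 * c * ‖defectOp A x‖ * ‖defectOp (adjoint A) y‖ := by
  have hleft : (contractionForm A (-adjoint A y, y) (-adjoint A y, y)).re =
      ‖defectOp (adjoint A) y‖ ^ 2 := by
    rw [re_contractionForm_self, norm_sq_defectOp (norm_adjoint_le_one hA), map_neg, norm_neg,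
      inner_neg_right, ← adjoint_inner_left, Complex.neg_re, ← RCLike.re_to_complex,
      inner_self_eq_norm_sq]
    ring
  have hright : (contractionForm A (x, -A x) (x, -A x)).re = ‖defectOp A x‖ ^ 2 := by
    rw [re_contractionForm_self, norm_sq_defectOp hA, norm_neg, inner_neg_left, Complex.neg_re,
      ← RCLike.re_to_complex, inner_self_eq_norm_sq]
    ring
  have hform (p : E × E') : ‖cornerForm C p p‖ ≤ (((c : ℂ) • contractionForm A) p p).re := by
    rw [cornerForm_apply, LinearMap.smul_apply, LinearMap.smul_apply, smul_eq_mul,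
      Complex.re_ofReal_mul]
    exact h p
  have hcauchy := norm_apply_sq_le_of_norm_apply_self_le hform (-adjoint A y, y) (x, -A x)
  simp only [cornerForm_apply, LinearMap.smul_apply, smul_eq_mul, Complex.re_ofReal_mul, hleft,
    hright] at hcauchy
  refine le_of_sq_le_sq (hcauchy.trans_eq ?_) (by positivity)
  ring

theorem norm_perturb_le_one_iff (hA : ‖A‖ ≤ 1)
    {Y : defectSpace A →L[ℂ] defectSpace (adjoint A)} :
    ‖perturb A Y‖ ≤ 1 ↔ ∀ v, ‖Y v‖ ≤ ‖v - adjointRestrict A hA (Y v)‖ := by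
  constructor
  · intro hAY v
    induction v using (denseRange_defectOpRestrict A).induction_on with
    | hp => exact isClosed_le (by fun_prop) (by fun_prop)
    | ih x =>
      refine le_of_sq_le_sq ?_ (norm_nonneg _)
      rw [← sub_nonneg, ← norm_sq_sub_norm_sq_perturb_apply hA, sub_nonneg]
      exact pow_le_pow_left₀ (norm_nonneg _) (norm_apply_le_of_norm_le_one hAY x) 2
  · refine fun h => opNorm_le_bound _ zero_le_one fun x => ?_
    rw [one_mul]
    refine le_of_sq_le_sq ?_ (norm_nonneg _)
    rw [← sub_nonneg, norm_sq_sub_norm_sq_perturb_apply hA, sub_nonneg]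
    exact pow_le_pow_left₀ (norm_nonneg _) (h _) 2

theorem norm_sq_le_mul_of_forall_norm_defectOp_le {k : ℝ}
    {Y : defectSpace A →L[ℂ] defectSpace (adjoint A)} (hA : ‖A‖ ≤ 1) (hAY : ‖perturb A Y‖ ≤ 1)
    (h : ∀ x, ‖defectOp A x‖ ≤ k * ‖defectOp (perturb A Y) x‖) (v : defectSpace A) :
    ‖v‖ ^ 2 ≤ k ^ 2 * (‖v - adjointRestrict A hA (Y v)‖ ^ 2 - ‖Y v‖ ^ 2) := by
  induction v using (denseRange_defectOpRestrict A).induction_on with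
  | hp => exact isClosed_le (by fun_prop) (by fun_prop)
  | ih x =>
    rw [← norm_sq_sub_norm_sq_perturb_apply hA, ← norm_sq_defectOp hAY, ← mul_pow]
    exact pow_le_pow_left₀ (norm_nonneg _) (h x) 2

theorem differentiable_perturb (A : E →L[ℂ] E') : Differentiable ℂ (perturb A) :=
  differentiable_const_add_comp_comp A
    (defectOp (adjoint A) ∘L (defectSpace (adjoint A)).subtypeL) (defectOpRestrict A)

theorem Equivalent.exists_mem_schurClass (hA : ‖A‖ ≤ 1) (hB : ‖B‖ ≤ 1) (h : Equivalent A B) :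
    ∃ l ∈ Metric.ball (0 : ℂ) 1, ∃ F ∈ Kobayashi.schurClass E E', F 0 = A ∧ F l = B := by
  obtain ⟨Y, rfl⟩ := dominates_iff_exists_eq_perturb.1 h.1
  obtain ⟨k, hk, hdefect⟩ := h.2.exists_norm_defectOp_le hB hA
  have hN := norm_adjointRestrict_le_one hA
  obtain ⟨r, hr, hr1, hY⟩ := exists_norm_apply_le_mul_norm_sub hk hN
    (norm_sq_le_mul_of_forall_norm_defectOp_le hA hB hdefect)
  obtain ⟨l, hl, G, hG, hle, hG0, hGl⟩ := exists_differentiableOn_interpolating hr hr1 hN hY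
  refine ⟨l, hl, fun z => perturb A (G z), ⟨?_, fun z hz => ?_⟩, ?_, ?_⟩
  · exact ((differentiable_perturb A).comp_differentiableOn hG).analyticOnNhd Metric.isOpen_ball
  · exact (norm_perturb_le_one_iff hA).2 (hle z hz)
  · beta_reduce
    rw [hG0, perturb_zero]
  · beta_reduce
    rw [hGl]

end Shmulyan

namespace Kobayashi

open ContinuousLinearMap Shmulyan Metric

variable {E E' : Type*}
  [NormedAddCommGroup E] [InnerProductSpace ℂ E]
  [NormedAddCommGroup E'] [InnerProductSpace ℂ E']
  {F : ℂ → E →L[ℂ] E'} {l : ℂ}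

theorem norm_inner_sub_le_min_re_contractionForm (hF : F ∈ schurClass E E') (hl : l ∈ ball 0 1)
    (p : E × E') :
    ‖⟪p.2, (F l - F 0) p.1⟫_ℂ‖ ≤ ‖l‖ / (1 - ‖l‖) *
      min (contractionForm (F 0) p p).re (contractionForm (F l) p p).re := by
  have hdiff : DifferentiableOn ℂ (fun z => contractionForm (F z) p p) (ball 0 1) :=
    (((innerSL ℂ p.2).differentiable.comp_differentiableOn
      (hF.1.differentiableOn.clm_apply (differentiableOn_const p.1))).const_mul 2).const_add _
  have hpick := one_sub_mul_norm_sub_le_min_re hdiff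
    (fun z hz => re_contractionForm_self_nonneg (hF.2 z hz) p) hl
  have hsub : contractionForm (F l) p p - contractionForm (F 0) p p =
      2 * ⟪p.2, (F l - F 0) p.1⟫_ℂ := by
    rw [contractionForm_apply, contractionForm_apply, sub_apply, inner_sub_right]
    ring
  rw [dist_zero_right, div_one, hsub, norm_mul, Complex.norm_ofNat] at hpick
  rw [div_mul_eq_mul_div, le_div_iff₀ (sub_pos.2 (mem_ball_zero_iff.1 hl))]
  linarith

theorem isAdmissible_of_mem_schurClass (hF : F ∈ schurClass E E') (hl : l ∈ ball 0 1) :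
    IsAdmissible (F 0) (F l) (n := 0) fun _ => l :=
  ⟨fun _ => hl, fun _ => F, fun _ => hF, rfl, fun j => j.elim0, rfl⟩

theorem pseudoDist_lt_top_iff {T T' : E →L[ℂ] E'} :
    pseudoDist T T' < ⊤ ↔
      ∃ (n : ℕ) (lam : Fin (n + 1) → ℂ), IsAdmissible T T' lam := by
  simp [pseudoDist, iInf_lt_iff]

theorem IsAdmissible.norm_left_le_one {T T' : E →L[ℂ] E'} {n : ℕ} {lam : Fin (n + 1) → ℂ}
    (h : IsAdmissible T T' lam) : ‖T‖ ≤ 1 := by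
  obtain ⟨_, F, hF, rfl, _⟩ := h
  exact (hF 0).2 0 (mem_ball_self one_pos)

theorem IsAdmissible.norm_right_le_one {T T' : E →L[ℂ] E'} {n : ℕ} {lam : Fin (n + 1) → ℂ}
    (h : IsAdmissible T T' lam) : ‖T'‖ ≤ 1 := by
  obtain ⟨hlam, F, hF, _, _, rfl⟩ := h
  exact (hF _).2 _ (hlam _)

variable [CompleteSpace E] [CompleteSpace E']

theorem equivalent_of_mem_schurClass (hF : F ∈ schurClass E E') (hl : l ∈ ball 0 1) :
    Equivalent (F 0) (F l) := by
  have hc : 0 ≤ ‖l‖ / (1 - ‖l‖) :=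
    div_nonneg (norm_nonneg l) (sub_nonneg.2 (mem_ball_zero_iff.1 hl).le)
  have hle := norm_inner_sub_le_min_re_contractionForm hF hl
  constructor
  · refine dominates_iff_exists_norm_inner_sub_le.2 ⟨_, mul_nonneg zero_le_two hc,
      norm_inner_le_of_norm_inner_le_re_contractionForm (hF.2 0 (by simp)) hc fun p => ?_⟩
    exact (hle p).trans (by gcongr; exact min_le_left _ _)
  · refine dominates_iff_exists_norm_inner_sub_le.2 ⟨_, mul_nonneg zero_le_two hc,
      norm_inner_le_of_norm_inner_le_re_contractionForm (hF.2 l hl) hc fun p => ?_⟩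
    rw [← neg_sub (F l), neg_apply, inner_neg_right, norm_neg]
    exact (hle p).trans (by gcongr; exact min_le_right _ _)

theorem IsAdmissible.equivalent {T T' : E →L[ℂ] E'} {n : ℕ} {lam : Fin (n + 1) → ℂ}
    (h : IsAdmissible T T' lam) : Equivalent T T' := by
  obtain ⟨hlam, F, hF, hstart, hstep, hend⟩ := h
  have hzero : (0 : ℂ) ∈ ball 0 1 := by simp
  have hreach (j : Fin (n + 1)) : Equivalent T (F j (lam j)) := by
    induction j using Fin.induction with
    | zero => exact hstart ▸ equivalent_of_mem_schurClass (hF 0) (hlam 0)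
    | succ j ih =>
      refine ih.trans (hstart ▸ (hF 0).2 0 hzero) ((hF _).2 _ (hlam _)) ((hF _).2 _ (hlam _)) ?_
      rw [hstep j]
      exact equivalent_of_mem_schurClass (hF _) (hlam _)
  exact hend ▸ hreach (Fin.last n)

end Kobayashi

theorem mainTheorem5_general {E E' : Type*}
    [NormedAddCommGroup E] [InnerProductSpace ℂ E] [CompleteSpace E]
    [NormedAddCommGroup E'] [InnerProductSpace ℂ E'] [CompleteSpace E'] (T T' : E →L[ℂ] E') :
    List.TFAE
      [∃ P ∈ Shmulyan.parts E E', T ∈ P ∧ T' ∈ P,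
       ∃ lam₀ ∈ Metric.ball (0 : ℂ) 1, ∃ F ∈ Kobayashi.schurClass E E',
         F 0 = T ∧ F lam₀ = T',
       Kobayashi.pseudoDist T T' < ⊤] := by
  rw [Shmulyan.exists_mem_parts_iff, Kobayashi.pseudoDist_lt_top_iff]
  tfae_have 1 → 2 := fun ⟨hT, hT', h⟩ => h.exists_mem_schurClass hT hT'
  tfae_have 2 → 3 := fun ⟨_, hl, _, hF, h0, hl'⟩ =>
    ⟨0, _, h0 ▸ hl' ▸ Kobayashi.isAdmissible_of_mem_schurClass hF hl⟩
  tfae_have 3 → 1 := fun ⟨_, _, h⟩ => ⟨h.norm_left_le_one, h.norm_right_le_one, h.equivalent⟩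
  tfae_finish

theorem mainTheorem5
    {E E' : Type*}
    [NormedAddCommGroup E] [InnerProductSpace ℂ E] [CompleteSpace E]
    [TopologicalSpace.SeparableSpace E]
    [NormedAddCommGroup E'] [InnerProductSpace ℂ E'] [CompleteSpace E']
    [TopologicalSpace.SeparableSpace E']
    (T T' : E →L[ℂ] E')
    (hT : T ∈ Shmulyan.contractions E E') (hT' : T' ∈ Shmulyan.contractions E E') :
    List.TFAE
      [∃ P ∈ Shmulyan.parts E E', T ∈ P ∧ T' ∈ P,
       ∃ lam₀ ∈ Metric.ball (0 : ℂ) 1, ∃ F ∈ Kobayashi.schurClass E E',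
         F 0 = T ∧ F lam₀ = T',
       Kobayashi.pseudoDist T T' < ⊤] :=
  mainTheorem5_general T T'
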